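/- Let $m,n>1$ be integers and consider the system $$A'=A\,[P-\Sigma],\quad B'=B\,[Q-\Sigma],\quad P'=P\,[1-\Sigma]-(m+n-1)A^2,\quad Q'=Q\,[1-\Sigma]-(m+n-1)B^2,\qquad \Sigma:=mP^2+nQ^2,$$ ($'=d/d\tau$) on the state space $S$ of all $(A,B,P,Q)\in\mathbb R^4$ with $A>0$, $B>0$, $mP+nQ=1$ and $\Sigma+(m+n-1)(mA^2+nB^2)=1$. An orbit is a solution $X:\mathbb R\to S$. Its possible limit points include $$F_{1,2}:\ (0,0,p,q)\ \text{with}\ mp+nq=1,\ mp^2+nq^2=1;\qquad F_*:\ A=B=P=Q=\tfrac1{m+n};$$ $$F_A:\ A=0,\ B=\sqrt{\tfrac{n-1}{n^2(m+n-1)}},\ P=0,\ Q=\tfrac1n;\qquad F_B:\ A=\sqrt{\tfrac{m-1}{m^2(m+n-1)}},\ B=0,\ P=\tfrac1m,\ Q=0.$$ Positive functions $a,b$ of a variable $t$ are generated by $X$ if there is a time function $t=t(\tau)$ with $dt/d\tau=1/H$ and $t\to0$ as $\tau\to\infty$, such that along $t(\tau)$ one has $$X=(A,B,P,Q)=\Big(-\frac1{aH},\,-\frac1{bH},\,\frac{p}{H},\,\frac{q}{H}\Big),\qquad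 p=-\dot a/a,\quad q=-\dot b/b,\quad H=mp+nq .$$ Every orbit $X$ generates such a pair $(a,b)$. Whenever $(a,b)$ is generated by $X$, the time function is a strictly decreasing map of $\mathbb R$ onto $(0,\infty)$, and on $(0,\infty)$ the pair $(a,b)$ solves the vacuum Einstein equations of the metric $-dt^2+a^2g+b^2h$ over Einstein spaces of dimensions $m$ and $n$ with $\mathrm{Ric}_g=-(m+n-1)g$, $\mathrm{Ric}_h=-(m+n-1)h$, that is, the equations $$\dot p=pH-\frac{m+n-1}{a^2},\qquad \dot q=qH-\frac{m+n-1}{b^2},\qquad 0=-\frac{m(m+n-1)}{a^2}-\frac{n(m+n-1)}{b^2}+H^2-(mp^2+nq^2).$$ Moreover: 1. (Kasner type) If $X\to(0,0,p,q)$ as $\tau\to\infty$, where $p,q$ are now constants with $mp+nq=1$ and $mp^2+nq^2=1$ (i.e. $X$ converges to $F_1$ or $F_2$), then $a\sim t^p$ and $b\sim t^q$ as $t\searrow0$, in the sense that $a/t^p$ and $b/t^q$ have positive finite limits. 2. (Friedmann type) If $X\to F_*$ as $\tau\to-\infty$, then $a\sim t$ and $b\sim t$ as $t\to\infty$; in fact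 $a/t\to1$ and $b/t\to1$. 3. If $X\to F_A$ as $\tau\to\infty$, then as $t\searrow0$ the function $a$ converges to a positive constant and $b\sim t$, in fact $b/t\to\sqrt{m+n-1}/\sqrt{n-1}$. If $X\to F_B$ as $\tau\to\infty$, then as $t\searrow0$ one has $a\sim t$, in fact $a/t\to\sqrt{m+n-1}/\sqrt{m-1}$, and $b$ converges to a positive constant. -/

import Mathlib

open Filter Topology Set

noncomputable section

namespace DoublyWarped

/-! Doubly warped products `-dt² + a(t)² g + b(t)² h` over Einstein manifolds `(M, g)`, `(N, h)` of
dimensions `m` and `n` with `Ric g = kg (m + n - 1) g`, `Ric h = kh (m + n - 1) h`. -/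

/-- The principal curvature `-ȧ/a` of a scale factor `a`. -/
def curv (a : ℝ → ℝ) (t : ℝ) : ℝ := -(deriv a t) / a t

/-- The mean curvature `H = m p + n q` with `p = -ȧ/a`, `q = -ḃ/b`. -/
def meanCurv (m n : ℕ) (a b : ℝ → ℝ) (t : ℝ) : ℝ := m * curv a t + n * curv b t

/-- The scale factors `a`, `b` are positive and satisfy the vacuum Einstein equations of the doubly
warped product metric on the time set `I` (meant to be open): the two evolution equations and the
Hamiltonian constraint. -/
structure IsVacuumSolution (m n : ℕ) (kg kh : ℝ) (a b : ℝ → ℝ) (I : Set ℝ) : Prop where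
  a_pos : ∀ t ∈ I, 0 < a t
  b_pos : ∀ t ∈ I, 0 < b t
  a_diff : ∀ t ∈ I, DifferentiableAt ℝ a t
  b_diff : ∀ t ∈ I, DifferentiableAt ℝ b t
  evol_p : ∀ t ∈ I, HasDerivAt (curv a)
    (curv a t * meanCurv m n a b t + kg * ((m + n - 1) / a t ^ 2)) t
  evol_q : ∀ t ∈ I, HasDerivAt (curv b)
    (curv b t * meanCurv m n a b t + kh * ((m + n - 1) / b t ^ 2)) t
  constraint : ∀ t ∈ I,
    0 = kg * (m * (m + n - 1) / a t ^ 2) + kh * (n * (m + n - 1) / b t ^ 2)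
      + meanCurv m n a b t ^ 2 - (m * curv a t ^ 2 + n * curv b t ^ 2)

/-- The scale invariant variables `(A, B, P, Q)` of a pair of scale factors at time `t`. -/
def scaleInvariant (m n : ℕ) (a b : ℝ → ℝ) (t : ℝ) : ℝ × ℝ × ℝ × ℝ :=
  (-1 / (a t * meanCurv m n a b t), -1 / (b t * meanCurv m n a b t),
    curv a t / meanCurv m n a b t, curv b t / meanCurv m n a b t)

/-- The right-hand side of the reduced dynamical system at `(A, B, P, Q)`. -/
def vectorField (m n : ℕ) (kg kh : ℝ) : ℝ × ℝ × ℝ × ℝ → ℝ × ℝ × ℝ × ℝ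
  | (A, B, P, Q) =>
    (A * (P - (m * P ^ 2 + n * Q ^ 2)),
     B * (Q - (m * P ^ 2 + n * Q ^ 2)),
     P * (1 - (m * P ^ 2 + n * Q ^ 2)) + (m + n - 1) * kg * A ^ 2,
     Q * (1 - (m * P ^ 2 + n * Q ^ 2)) + (m + n - 1) * kh * B ^ 2)

/-- The physical state space: the points `(A, B, P, Q)` with `A, B > 0` that satisfy both
constraints. -/
def stateSpace (m n : ℕ) (kg kh : ℝ) : Set (ℝ × ℝ × ℝ × ℝ) :=
  {x | match x with
    | (A, B, P, Q) =>
      (m * P + n * Q - 1 = 0) ∧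
      ((m * P ^ 2 + n * Q ^ 2) - (m + n - 1) * (kg * m * A ^ 2 + kh * n * B ^ 2) - 1 = 0) ∧
      0 < A ∧ 0 < B}

/-- `X` parametrizes an orbit of the reduced dynamical system in the physical state space for
`kg = kh = -1`. The closure of that state space is compact and invariant, so orbits exist for all
times `τ ∈ ℝ`. -/
structure IsOrbit (m n : ℕ) (X : ℝ → ℝ × ℝ × ℝ × ℝ) : Prop where
  mem : ∀ τ, X τ ∈ stateSpace m n (-1) (-1)
  deriv_eq : ∀ τ, HasDerivAt X (vectorField m n (-1) (-1) (X τ)) τ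

/-- The orbit `X` generates the scale factors `a`, `b`; here `T τ` is the proper time `t` as a
function of `τ`. It satisfies `dt/dτ = 1/H`, and its origin is fixed by `t → 0` as `τ → ∞`. The scale
invariant variables of `(a, b)` at time `T τ` are `X τ`. -/
structure Generates (m n : ℕ) (X : ℝ → ℝ × ℝ × ℝ × ℝ) (T a b : ℝ → ℝ) : Prop where
  time_deriv : ∀ τ, HasDerivAt T (1 / meanCurv m n a b (T τ)) τ
  time_origin : Tendsto T atTop (𝓝 0)
  a_pos : ∀ τ, 0 < a (T τ)
  b_pos : ∀ τ, 0 < b (T τ)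
  a_diff : ∀ τ, DifferentiableAt ℝ a (T τ)
  b_diff : ∀ τ, DifferentiableAt ℝ b (T τ)
  variables_eq : ∀ τ, scaleInvariant m n a b (T τ) = X τ

/-- The generalized Kasner relations. -/
def IsKasner (m n : ℕ) (p q : ℝ) : Prop :=
  m * p + n * q = 1 ∧ m * p ^ 2 + n * q ^ 2 = 1

/-- The equilibrium points `F₁`, `F₂` are the points `kasnerPoint P Q` with `IsKasner m n P Q`. -/
def kasnerPoint (P Q : ℝ) : ℝ × ℝ × ℝ × ℝ := (0, 0, P, Q)

/-- The equilibrium point `F_A`. -/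
def pointA (m n : ℕ) : ℝ × ℝ × ℝ × ℝ :=
  (0, √((n - 1) / n ^ 2 * (1 / (m + n - 1))), 0, 1 / n)

/-- The equilibrium point `F_B`. -/
def pointB (m n : ℕ) : ℝ × ℝ × ℝ × ℝ :=
  (√((m - 1) / m ^ 2 * (1 / (m + n - 1))), 0, 1 / m, 0)

/-- The equilibrium point `F_*`. -/
def pointStar (m n : ℕ) : ℝ × ℝ × ℝ × ℝ :=
  (1 / (m + n), 1 / (m + n), 1 / (m + n), 1 / (m + n))

end DoublyWarped

end

/-! Everything is expressed through the Hubble length V = -1/H. Along an orbit V' = -S V with S =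
mP² + nQ², T' = -V, a = V/A and b = V/B, so the theorem is about comparing V, A and T as functions
of τ. The two constraints give 1/(m+n) ≤ S ≤ 1. Hence V and T are comparable with exponentials, T is
a decreasing bijection onto (0,∞) once T → 0 is imposed, and the vacuum equations are the orbit
equations rewritten in t.

If S → s ≠ 0, then T/V → 1/s by L'Hôpital (`tendsto_T_div_V_atTop`, `tendsto_T_div_V_atBot`). If A
also has a nonzero limit α, then a/t → s/α. This settles F_* and the growing factor at F_A and F_B.

If A → 0, a rate is needed. Since (log (V/A))' = -P and (log V)' = -S, the task is to bound the
derivative of log (V/A) - p log V by an exponentially decaying quantity, which makes it converge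
(`exists_tendsto_of_abs_deriv_le`). At a Kasner point p, q < 1, so A² + B² decays and controls both
P - p and 1 - S. At F_A, p = 0 and A² decays; a one-sided comparison (`nonpos_of_tendsto_zero`)
gives 0 ≤ P ≤ 4(m+n-1)A². F_B follows by exchanging the factors. -/

namespace DoublyWarped

/-! ### Limits from differential inequalities -/

lemma antitoneOn_of_hasDerivAt {D : Set ℝ} (hD : Convex ℝ D) {f f' : ℝ → ℝ}
    (hf : ∀ x ∈ D, HasDerivAt f (f' x) x) (hf' : ∀ x ∈ D, f' x ≤ 0) : AntitoneOn f D :=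
  antitoneOn_of_hasDerivWithinAt_nonpos hD
    (fun x hx => (hf x hx).continuousAt.continuousWithinAt)
    (fun x hx => (hf x (interior_subset hx)).hasDerivWithinAt)
    (fun x hx => hf' x (interior_subset hx))

lemma monotoneOn_of_hasDerivAt {D : Set ℝ} (hD : Convex ℝ D) {f f' : ℝ → ℝ}
    (hf : ∀ x ∈ D, HasDerivAt f (f' x) x) (hf' : ∀ x ∈ D, 0 ≤ f' x) : MonotoneOn f D :=
  monotoneOn_of_hasDerivWithinAt_nonneg hD
    (fun x hx => (hf x hx).continuousAt.continuousWithinAt)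
    (fun x hx => (hf x (interior_subset hx)).hasDerivWithinAt)
    (fun x hx => hf' x (interior_subset hx))

/-- A function whose derivative is controlled by an exponentially decaying quantity `E` converges,
and its distance to the limit is controlled by `E`. -/
lemma exists_tendsto_of_abs_deriv_le {f f' E E' : ℝ → ℝ} {K c x₀ : ℝ} (hc : 0 < c) (hK : 0 ≤ K)
    (hf : ∀ x, HasDerivAt f (f' x) x) (hE : ∀ x, HasDerivAt E (E' x) x)
    (hE0 : ∀ x, 0 ≤ E x) (hE' : ∀ x ≥ x₀, E' x ≤ -c * E x) (hf' : ∀ x ≥ x₀, |f' x| ≤ K * E x)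
    (hlim : Tendsto E atTop (𝓝 0)) :
    ∃ l, Tendsto f atTop (𝓝 l) ∧ ∀ x ≥ x₀, |f x - l| ≤ K / c * E x := by
  have hKc : 0 ≤ K / c := by positivity
  have key : ∀ x ≥ x₀, K / c * E' x ≤ -(K * E x) := fun x hx => by
    calc K / c * E' x ≤ K / c * (-c * E x) := mul_le_mul_of_nonneg_left (hE' x hx) hKc
      _ = -(K * E x) := by field_simp
  -- The weight K/c makes the derivative of (K/c)E at most -K E, which dominates |f'|; f is trapped
  -- between a decreasing and an increasing function with vanishing gap.
  have h1 : AntitoneOn (fun x => f x + K / c * E x) (Ici x₀) :=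
    antitoneOn_of_hasDerivAt (convex_Ici _) (fun x _ => (hf x).add ((hE x).const_mul (K / c)))
      fun x hx => by linarith [key x hx, (abs_le.1 (hf' x hx)).2]
  have h2 : MonotoneOn (fun x => f x - K / c * E x) (Ici x₀) :=
    monotoneOn_of_hasDerivAt (convex_Ici _) (fun x _ => (hf x).sub ((hE x).const_mul (K / c)))
      fun x hx => by linarith [key x hx, (abs_le.1 (hf' x hx)).1]
  -- Freezing the argument below x₀ gives a function that is antitone on all of ℝ.
  have h3 : Antitone fun x => f (max x x₀) + K / c * E (max x x₀) := fun x y hxy =>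
    h1 (mem_Ici.2 (le_max_right x x₀)) (mem_Ici.2 (le_max_right y x₀)) (max_le_max_right _ hxy)
  have h4 : BddBelow (range fun x => f (max x x₀) + K / c * E (max x x₀)) := by
    refine ⟨f x₀ - K / c * E x₀, ?_⟩
    rintro _ ⟨x, rfl⟩
    have := h2 (mem_Ici.2 le_rfl) (le_max_right x x₀ : max x x₀ ∈ Ici x₀) (le_max_right x x₀)
    have := mul_nonneg hKc (hE0 (max x x₀))
    simp only at *
    linarith
  obtain ⟨l, hl⟩ : ∃ l, Tendsto (fun x => f (max x x₀) + K / c * E (max x x₀)) atTop (𝓝 l) :=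
    ⟨_, tendsto_atTop_ciInf h3 h4⟩
  have h5 : Tendsto (fun x => f x + K / c * E x) atTop (𝓝 l) :=
    hl.congr' <| (eventually_ge_atTop x₀).mono fun x hx => by simp only [max_eq_left hx]
  have h6 : Tendsto f atTop (𝓝 l) := by simpa using h5.sub (hlim.const_mul (K / c))
  have h7 : Tendsto (fun x => f x - K / c * E x) atTop (𝓝 l) := by
    simpa using h6.sub (hlim.const_mul (K / c))
  refine ⟨l, h6, fun x hx => abs_le.2 ⟨?_, ?_⟩⟩
  · have : l ≤ f x + K / c * E x := le_of_tendsto h5 <| (eventually_ge_atTop x).mono fun y hy =>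
      h1 hx (le_trans hx hy) hy
    linarith
  · have : f x - K / c * E x ≤ l := ge_of_tendsto h7 <| (eventually_ge_atTop x).mono fun y hy =>
      h2 hx (le_trans hx hy) hy
    linarith

/-- L'Hôpital's rule at `-∞` for a denominator tending to infinity. -/
lemma tendsto_div_atBot_of_tendsto_deriv {f g r g' : ℝ → ℝ} {L : ℝ}
    (hf : ∀ x, HasDerivAt f (r x * g' x) x) (hg : ∀ x, HasDerivAt g (g' x) x)
    (hg' : ∀ x, g' x ≤ 0) (hr : Tendsto r atBot (𝓝 L)) (hlim : Tendsto g atBot atTop) :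
    Tendsto (fun x => f x / g x) atBot (𝓝 L) := by
  rw [Metric.tendsto_nhds]
  intro ε hε
  obtain ⟨x₀, hx₀⟩ := eventually_atBot.1 (Metric.tendsto_nhds.1 hr (ε / 2) (half_pos hε))
  have hb : ∀ x ≤ x₀, |r x - L| < ε / 2 := hx₀
  -- Integrating the bounds on r from x to x₀ compares f with (L ± ε/2) g up to a constant, which
  -- disappears after division by g.
  have h1 : AntitoneOn (fun x => f x - (L - ε / 2) * g x) (Iic x₀) :=
    antitoneOn_of_hasDerivAt (convex_Iic _) (fun x _ => (hf x).sub ((hg x).const_mul _))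
      fun x hx => by nlinarith [(abs_lt.1 (hb x hx)).1, hg' x]
  have h2 : MonotoneOn (fun x => f x - (L + ε / 2) * g x) (Iic x₀) :=
    monotoneOn_of_hasDerivAt (convex_Iic _) (fun x _ => (hf x).sub ((hg x).const_mul _))
      fun x hx => by nlinarith [(abs_lt.1 (hb x hx)).2, hg' x]
  have hz : ∀ c : ℝ, Tendsto (fun x => c / g x) atBot (𝓝 0) := fun c => hlim.const_div_atTop c
  have e1 := Metric.tendsto_nhds.1 (hz (f x₀ - (L - ε / 2) * g x₀)) (ε / 2) (half_pos hε)
  have e2 := Metric.tendsto_nhds.1 (hz (f x₀ - (L + ε / 2) * g x₀)) (ε / 2) (half_pos hε)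
  filter_upwards [e1, e2, eventually_le_atBot x₀, hlim.eventually_gt_atTop 0]
    with x e1 e2 hx hpos
  have a1 := h1 hx (mem_Iic.2 le_rfl) hx
  have a2 := h2 hx (mem_Iic.2 le_rfl) hx
  rw [Real.dist_eq, sub_zero, abs_lt] at e1 e2
  rw [Real.dist_eq, abs_lt]
  simp only at a1 a2
  have b1 : (f x₀ - (L - ε / 2) * g x₀) / g x ≤ f x / g x - (L - ε / 2) := by
    rw [div_le_iff₀ hpos, sub_mul (f x / g x), div_mul_cancel₀ _ hpos.ne']; exact a1
  have b2 : f x / g x - (L + ε / 2) ≤ (f x₀ - (L + ε / 2) * g x₀) / g x := by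
    rw [le_div_iff₀ hpos, sub_mul (f x / g x), div_mul_cancel₀ _ hpos.ne']; exact a2
  constructor <;> linarith

/-- A solution of the differential inequality `G' ≥ s G` that tends to zero is nonpositive. Here
`w` is a positive integrating factor, with `w' = -s w`. -/
lemma nonpos_of_tendsto_zero {G G' s w : ℝ → ℝ} {x₀ : ℝ} (hG : ∀ x, HasDerivAt G (G' x) x)
    (hw : ∀ x, HasDerivAt w (-(s x * w x)) x) (hw0 : ∀ x, 0 < w x) (hs : ∀ x, 0 ≤ s x)
    (hG' : ∀ x ≥ x₀, s x * G x ≤ G' x) (hlim : Tendsto G atTop (𝓝 0)) :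
    ∀ x ≥ x₀, G x ≤ 0 := by
  have h1 : MonotoneOn (fun x => G x * w x) (Ici x₀) :=
    monotoneOn_of_hasDerivAt (convex_Ici _) (fun x _ => (hG x).mul (hw x))
      fun x hx => by nlinarith [hG' x hx, hw0 x]
  have h2 : AntitoneOn w univ :=
    antitoneOn_of_hasDerivAt convex_univ (fun x _ => hw x)
      fun x _ => by nlinarith [mul_nonneg (hs x) (hw0 x).le]
  intro x hx
  by_contra! hpos
  have : G x ≤ 0 := by
    refine ge_of_tendsto hlim <| (eventually_ge_atTop x).mono fun y hy => ?_
    have a := h1 hx (le_trans hx hy) hy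
    have b := h2 (mem_univ x) (mem_univ y) hy
    have c : G x * w y ≤ G y * w y := (mul_le_mul_of_nonneg_left b hpos.le).trans a
    exact le_of_mul_le_mul_right c (hw0 y)
  linarith

/-- An orbit of the reduced system in components, with `S = m P² + n Q²`, the Hubble length
`V = -1/H` and the proper time `T`. -/
structure OrbitData (m n : ℝ) (A B P Q S V T : ℝ → ℝ) : Prop where
  two_le_m : 2 ≤ m
  two_le_n : 2 ≤ n
  A_pos : ∀ x, 0 < A x
  B_pos : ∀ x, 0 < B x
  V_pos : ∀ x, 0 < V x
  lin : ∀ x, m * P x + n * Q x = 1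
  S_eq : ∀ x, S x = m * P x ^ 2 + n * Q x ^ 2
  quad : ∀ x, S x + (m + n - 1) * (m * A x ^ 2 + n * B x ^ 2) = 1
  dA : ∀ x, HasDerivAt A (A x * (P x - S x)) x
  dB : ∀ x, HasDerivAt B (B x * (Q x - S x)) x
  dP : ∀ x, HasDerivAt P (P x * (1 - S x) - (m + n - 1) * A x ^ 2) x
  dQ : ∀ x, HasDerivAt Q (Q x * (1 - S x) - (m + n - 1) * B x ^ 2) x
  dV : ∀ x, HasDerivAt V (-(S x * V x)) x
  dT : ∀ x, HasDerivAt T (-V x) x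
  T_lim : Tendsto T atTop (𝓝 0)

/-! ### Proper time and Hubble length along an orbit -/

namespace OrbitData

variable {m n : ℝ} {A B P Q S V T : ℝ → ℝ}

/-- Exchanging the two factors preserves the system and leaves S, V and T unchanged, so statements
about a transfer to b. -/
lemma symm (D : OrbitData m n A B P Q S V T) : OrbitData n m B A Q P S V T where
  two_le_m := D.two_le_n
  two_le_n := D.two_le_m
  A_pos := D.B_pos
  B_pos := D.A_pos
  V_pos := D.V_pos
  lin x := by linarith [D.lin x]
  S_eq x := by linarith [D.S_eq x]
  quad x := by linarith [D.quad x]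
  dA := D.dB
  dB := D.dA
  dP x := by simpa only [add_comm n m] using D.dQ x
  dQ x := by simpa only [add_comm n m] using D.dP x
  dV := D.dV
  dT := D.dT
  T_lim := D.T_lim

lemma S_le_one (D : OrbitData m n A B P Q S V T) (x : ℝ) : S x ≤ 1 := by
  have hm := D.two_le_m
  have hn := D.two_le_n
  have : 0 ≤ (m + n - 1) * (m * A x ^ 2 + n * B x ^ 2) :=
    mul_nonneg (by linarith) (by positivity)
  linarith [D.quad x]

/-- Cauchy–Schwarz for mP + nQ = 1, with the defect mn(P - Q)² made explicit. -/
lemma one_le_mul_S (D : OrbitData m n A B P Q S V T) (x : ℝ) : 1 ≤ (m + n) * S x := by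
  have hm := D.two_le_m
  have hn := D.two_le_n
  have h : (m + n) * S x = (m * P x + n * Q x) ^ 2 + m * n * (P x - Q x) ^ 2 := by
    rw [D.S_eq]; ring
  rw [h, D.lin]
  have : 0 ≤ m * n * (P x - Q x) ^ 2 := by positivity
  linarith

lemma S_pos (D : OrbitData m n A B P Q S V T) (x : ℝ) : 0 < S x := by
  have hm := D.two_le_m
  have hn := D.two_le_n
  nlinarith [D.one_le_mul_S x]

lemma abs_P_le_one (D : OrbitData m n A B P Q S V T) (x : ℝ) : |P x| ≤ 1 := by
  have hm := D.two_le_m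
  have hn := D.two_le_n
  have h1 := D.S_le_one x
  rw [D.S_eq] at h1
  rw [← sq_le_one_iff_abs_le_one]
  nlinarith [sq_nonneg (P x), sq_nonneg (Q x)]

lemma T_strictAnti (D : OrbitData m n A B P Q S V T) : StrictAnti T :=
  strictAnti_of_hasDerivAt_neg D.dT fun x => neg_neg_of_pos (D.V_pos x)

lemma T_pos (D : OrbitData m n A B P Q S V T) (x : ℝ) : 0 < T x :=
  (D.T_strictAnti.antitone.le_of_tendsto D.T_lim (x + 1)).trans_lt
    (D.T_strictAnti (lt_add_one x))

lemma V_antitone (D : OrbitData m n A B P Q S V T) : AntitoneOn V univ :=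
  antitoneOn_of_hasDerivAt convex_univ (fun x _ => D.dV x)
    fun x _ => by nlinarith [mul_pos (D.S_pos x) (D.V_pos x)]

lemma tendsto_T_atBot (D : OrbitData m n A B P Q S V T) : Tendsto T atBot atTop := by
  have h : AntitoneOn (fun x => T x + V 0 * x) (Iic 0) :=
    antitoneOn_of_hasDerivAt (convex_Iic _)
      (fun x _ => (D.dT x).add ((hasDerivAt_id x).const_mul (V 0)))
      fun x hx => by linarith [D.V_antitone (mem_univ x) (mem_univ 0) hx]
  have h2 : Tendsto (fun x => T 0 + (-V 0) * x) atBot atTop :=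
    tendsto_atTop_add_const_left _ _ <|
      (tendsto_const_mul_atTop_of_neg (neg_neg_of_pos (D.V_pos 0))).2 tendsto_id
  refine tendsto_atTop_mono' _ ?_ h2
  filter_upwards [eventually_le_atBot 0] with x hx
  have := h hx (mem_Iic.2 le_rfl) hx
  simp only at this
  linarith

lemma tendsto_V_atBot (D : OrbitData m n A B P Q S V T) : Tendsto V atBot atTop := by
  have hm := D.two_le_m
  have hn := D.two_le_n
  have h : MonotoneOn (fun x => T x - (m + n) * V x) univ :=
    monotoneOn_of_hasDerivAt convex_univ
      (fun x _ => (D.dT x).sub ((D.dV x).const_mul (m + n)))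
      fun x _ => by nlinarith [D.one_le_mul_S x, D.V_pos x]
  have h2 : Tendsto (fun x => (T x + -(T 0 - (m + n) * V 0)) / (m + n)) atBot atTop :=
    (tendsto_atTop_add_const_right _ _ D.tendsto_T_atBot).atTop_div_const (by linarith)
  refine tendsto_atTop_mono' _ ?_ h2
  filter_upwards [eventually_le_atBot 0] with x hx
  have := h (mem_univ x) (mem_univ 0) hx
  simp only at this
  rw [div_le_iff₀ (by linarith)]
  linarith

/-- V decreases, so T drops by at least V x on [x - 1, x]; as T stays positive, V x ≤ T (x - 1) → 0.
-/
lemma tendsto_V_atTop (D : OrbitData m n A B P Q S V T) : Tendsto V atTop (𝓝 0) := by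
  have h : ∀ x, V x ≤ T (x - 1) := fun x => by
    have h1 : AntitoneOn (fun y => T y + V x * y) (Iic x) :=
      antitoneOn_of_hasDerivAt (convex_Iic _)
        (fun y _ => (D.dT y).add ((hasDerivAt_id y).const_mul (V x)))
        fun y hy => by linarith [D.V_antitone (mem_univ y) (mem_univ x) hy]
    have := h1 (mem_Iic.2 (sub_one_lt x).le) (mem_Iic.2 le_rfl) (sub_one_lt x).le
    simp only at this
    linarith [D.T_pos x]
  exact squeeze_zero (fun x => (D.V_pos x).le) h
    (D.T_lim.comp (tendsto_atTop_add_const_right _ (-1) tendsto_id))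

lemma range_T (D : OrbitData m n A B P Q S V T) : range T = Ioi 0 := by
  refine Subset.antisymm (range_subset_iff.2 D.T_pos) fun t ht => ?_
  have hc : Continuous T := continuous_iff_continuousAt.2 fun x => (D.dT x).continuousAt
  obtain ⟨x, hx⟩ := (D.T_lim.eventually (gt_mem_nhds (mem_Ioi.1 ht))).exists
  obtain ⟨y, hy⟩ := (D.tendsto_T_atBot.eventually_gt_atTop t).exists
  exact mem_range_of_exists_le_of_exists_ge hc ⟨x, hx.le⟩ ⟨y, hy.le⟩

lemma tendsto_nhdsGT_zero (D : OrbitData m n A B P Q S V T) {f g : ℝ → ℝ} {l : Filter ℝ}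
    (hfg : ∀ x, f (T x) = g x) (hg : Tendsto g atTop l) : Tendsto f (𝓝[>] 0) l := by
  refine fun s hs => mem_map.2 ?_
  obtain ⟨x₀, hx₀⟩ := mem_atTop_sets.1 (hg hs)
  filter_upwards [Ioo_mem_nhdsGT (D.T_pos x₀)] with t ht
  obtain ⟨x, rfl⟩ : t ∈ range T := D.range_T ▸ ht.1
  simpa only [mem_preimage, hfg] using hx₀ x (D.T_strictAnti.lt_iff_gt.1 ht.2).le

lemma tendsto_atTop (D : OrbitData m n A B P Q S V T) {f g : ℝ → ℝ} {l : Filter ℝ}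
    (hfg : ∀ x, f (T x) = g x) (hg : Tendsto g atBot l) : Tendsto f atTop l := by
  refine fun s hs => mem_map.2 ?_
  obtain ⟨x₀, hx₀⟩ := mem_atBot_sets.1 (hg hs)
  filter_upwards [eventually_gt_atTop (T x₀)] with t ht
  obtain ⟨x, rfl⟩ : t ∈ range T := D.range_T ▸ (D.T_pos x₀).trans ht
  simpa only [mem_preimage, hfg] using hx₀ x (D.T_strictAnti.lt_iff_gt.1 ht).le

lemma hasDerivAt_comp_T (D : OrbitData m n A B P Q S V T) {f g : ℝ → ℝ} {g' x : ℝ}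
    (hfg : ∀ x, f (T x) = g x) (hg : HasDerivAt g g' x) : HasDerivAt f (-g' / V x) (T x) := by
  have hV := (D.V_pos x).ne'
  set R := Function.invFun T with hR
  have hRT : ∀ x, R (T x) = x := Function.leftInverse_invFun D.T_strictAnti.injective
  have hTR : ∀ t ∈ Ioi (0 : ℝ), T (R t) = t := fun t ht =>
    Function.invFun_eq (by simpa [D.range_T] using ht : t ∈ range T)
  have hnhds : Ioi (0 : ℝ) ∈ 𝓝 (T x) := Ioi_mem_nhds (D.T_pos x)
  have hcont : ContinuousAt R (T x) := by
    rw [ContinuousAt, hRT, tendsto_order]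
    refine ⟨fun y hy => ?_, fun y hy => ?_⟩
    · filter_upwards [hnhds, gt_mem_nhds (D.T_strictAnti hy)] with t ht hlt
      exact D.T_strictAnti.lt_iff_gt.1 (by rwa [hTR t ht])
    · filter_upwards [hnhds, lt_mem_nhds (D.T_strictAnti hy)] with t ht hlt
      exact D.T_strictAnti.lt_iff_gt.1 (by rwa [hTR t ht])
  have hRd : HasDerivAt R (-V x)⁻¹ (T x) :=
    HasDerivAt.of_local_left_inverse hcont (by rw [hRT]; exact D.dT x) (neg_ne_zero.2 hV)
      (by filter_upwards [hnhds] with t ht using hTR t ht)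
  have h : HasDerivAt (g ∘ R) (g' * (-V x)⁻¹) (T x) :=
    HasDerivAt.comp _ (by rwa [hRT]) hRd
  have he : f =ᶠ[𝓝 (T x)] g ∘ R := by
    filter_upwards [hnhds] with t ht
    rw [Function.comp_apply, ← hfg, hTR t ht]
  convert! h.congr_of_eventuallyEq he using 1
  field_simp

/-! ### Asymptotics of V/A in the time τ -/

lemma tendsto_T_div_V_atTop (D : OrbitData m n A B P Q S V T) {s : ℝ} (hs0 : s ≠ 0)
    (hs : Tendsto S atTop (𝓝 s)) : Tendsto (fun x => T x / V x) atTop (𝓝 s⁻¹) := by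
  refine HasDerivAt.lhopital_zero_atTop (Eventually.of_forall D.dT) (Eventually.of_forall D.dV)
    (Eventually.of_forall fun x => neg_ne_zero.2 (mul_pos (D.S_pos x) (D.V_pos x)).ne')
    D.T_lim D.tendsto_V_atTop ((hs.inv₀ hs0).congr fun x => ?_)
  have := (D.V_pos x).ne'
  have := (D.S_pos x).ne'
  field_simp

lemma tendsto_T_div_V_atBot (D : OrbitData m n A B P Q S V T) {s : ℝ} (hs0 : s ≠ 0)
    (hs : Tendsto S atBot (𝓝 s)) : Tendsto (fun x => T x / V x) atBot (𝓝 s⁻¹) := by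
  refine tendsto_div_atBot_of_tendsto_deriv (r := fun x => (S x)⁻¹) (fun x => ?_) D.dV
    (fun x => by linarith [mul_pos (D.S_pos x) (D.V_pos x)]) (hs.inv₀ hs0) D.tendsto_V_atBot
  convert! D.dT x using 1
  have := (D.S_pos x).ne'
  field_simp

/-- Asymptotics of the scale factor `a = V / A` when `A` tends to a nonzero limit. -/
lemma tendsto_div_of_tendsto {T V A : ℝ → ℝ} {l : Filter ℝ} {s α : ℝ}
    (h : Tendsto (fun x => T x / V x) l (𝓝 s⁻¹)) (hs : s ≠ 0) (hA : Tendsto A l (𝓝 α))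
    (hα : α ≠ 0) : Tendsto (fun x => V x / A x / T x) l (𝓝 (s / α)) := by
  have := (h.mul hA).inv₀ (mul_ne_zero (inv_ne_zero hs) hα)
  rw [mul_inv, inv_inv] at this
  refine this.congr fun x => ?_
  rw [mul_inv, inv_div]
  ring

lemma hasDerivAt_log_V (D : OrbitData m n A B P Q S V T) (x : ℝ) :
    HasDerivAt (fun x => Real.log (V x)) (-S x) x := by
  have := (D.V_pos x).ne'
  convert! (D.dV x).log this using 1
  field_simp

lemma hasDerivAt_log_A (D : OrbitData m n A B P Q S V T) (x : ℝ) :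
    HasDerivAt (fun x => Real.log (A x)) (P x - S x) x := by
  have := (D.A_pos x).ne'
  convert! (D.dA x).log this using 1
  field_simp

lemma hasDerivAt_A_sq (D : OrbitData m n A B P Q S V T) (x : ℝ) :
    HasDerivAt (fun x => A x ^ 2) (2 * A x ^ 2 * (P x - S x)) x := by
  convert! (D.dA x).pow 2 using 1
  push_cast
  ring

theorem exists_tendsto_kasner (D : OrbitData m n A B P Q S V T) {p q : ℝ}
    (hpq : m * p ^ 2 + n * q ^ 2 = 1) (hA : Tendsto A atTop (𝓝 0)) (hB : Tendsto B atTop (𝓝 0))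
    (hP : Tendsto P atTop (𝓝 p)) (hQ : Tendsto Q atTop (𝓝 q)) :
    ∃ l > 0, Tendsto (fun x => V x / A x / T x ^ p) atTop (𝓝 l) := by
  have hm := D.two_le_m
  have hn := D.two_le_n
  have hp : p < 1 := by nlinarith [sq_nonneg q, sq_nonneg p]
  have hp1 : |p| ≤ 1 := by
    rw [← sq_le_one_iff_abs_le_one]; nlinarith [sq_nonneg q, sq_nonneg p]
  have hq : q < 1 := by nlinarith [sq_nonneg q, sq_nonneg p]
  have hS : Tendsto S atTop (𝓝 1) := by
    rw [← hpq]
    exact (((hP.pow 2).const_mul m).add ((hQ.pow 2).const_mul n)).congr fun x => (D.S_eq x).symm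
  obtain ⟨d, hd0, hdp, hdq⟩ : ∃ d > 0, p - 1 < -d ∧ q - 1 < -d := by
    refine ⟨min (1 - p) (1 - q) / 2, ?_, ?_, ?_⟩
    · have := lt_min (sub_pos.2 hp) (sub_pos.2 hq); linarith
    · have := min_le_left (1 - p) (1 - q); linarith
    · have := min_le_right (1 - p) (1 - q); linarith
  obtain ⟨x₀, hx₀⟩ := eventually_atTop.1 <|
    ((hP.sub hS).eventually (gt_mem_nhds hdp)).and ((hQ.sub hS).eventually (gt_mem_nhds hdq))
  set k := m + n - 1 with hk
  have hk0 : 0 ≤ k := by linarith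
  set E : ℝ → ℝ := fun x => A x ^ 2 + B x ^ 2 with hE
  have hE0 : ∀ x, 0 ≤ E x := fun x => by positivity
  have dE : ∀ x, HasDerivAt E (2 * A x ^ 2 * (P x - S x) + 2 * B x ^ 2 * (Q x - S x)) x :=
    fun x => (D.hasDerivAt_A_sq x).add (D.symm.hasDerivAt_A_sq x)
  have hE' : ∀ x ≥ x₀, 2 * A x ^ 2 * (P x - S x) + 2 * B x ^ 2 * (Q x - S x)
      ≤ -(2 * d) * E x := fun x hx => by
    have h1 := mul_le_mul_of_nonneg_left (hx₀ x hx).1.le (by positivity : 0 ≤ 2 * A x ^ 2)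
    have h2 := mul_le_mul_of_nonneg_left (hx₀ x hx).2.le (by positivity : 0 ≤ 2 * B x ^ 2)
    simp only [hE]
    linarith
  have hElim : Tendsto E atTop (𝓝 0) := by simpa using (hA.pow 2).add (hB.pow 2)
  have hS1 : ∀ x, |1 - S x| ≤ k * (m + n) * E x := fun x => by
    rw [abs_of_nonneg (by linarith [D.S_le_one x])]
    have h1 : 1 - S x = k * (m * A x ^ 2 + n * B x ^ 2) := by linarith [D.quad x]
    rw [h1, mul_assoc]
    refine mul_le_mul_of_nonneg_left ?_ hk0
    simp only [hE]
    nlinarith [sq_nonneg (A x), sq_nonneg (B x)]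
  have hPS : ∀ r x, |r| ≤ 1 → |r * (1 - S x)| ≤ k * (m + n) * E x := fun r x hr => by
    rw [abs_mul]
    exact (mul_le_of_le_one_left (abs_nonneg _) hr).trans (hS1 x)
  -- The convergence of P is already known; the gain is the rate |P - p| = O(E).
  obtain ⟨p', hp', hpb⟩ := exists_tendsto_of_abs_deriv_le (K := k * (m + n) + k) (c := 2 * d)
    (x₀ := x₀) (by positivity) (by positivity) D.dP dE hE0 hE' (fun x _ => by
      refine (abs_sub _ _).trans ?_
      have h1 := hPS (P x) x (D.abs_P_le_one x)
      have h2 : |k * A x ^ 2| ≤ k * E x := by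
        rw [abs_of_nonneg (by positivity)]
        exact mul_le_mul_of_nonneg_left (by simp only [hE]; nlinarith [sq_nonneg (B x)]) hk0
      linarith) hElim
  obtain rfl := tendsto_nhds_unique hp' hP
  -- This function is log (a / V^p), with derivative -(P - p) - p(1 - S) = O(E). Replacing V by T
  -- afterwards costs nothing in the existence of the limit, because T/V → 1.
  obtain ⟨l, hl, -⟩ := exists_tendsto_of_abs_deriv_le
    (f := fun x => (1 - p') * Real.log (V x) - Real.log (A x))
    (K := (k * (m + n) + k) / (2 * d) + k * (m + n)) (c := 2 * d)
    (x₀ := x₀) (by positivity) (by positivity)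
    (fun x => ((D.hasDerivAt_log_V x).const_mul (1 - p')).sub (D.hasDerivAt_log_A x))
    dE hE0 hE' (fun x hx => by
      have h1 := hpb x hx
      have h2 := hPS p' x hp1
      have h3 : (1 - p') * -S x - (P x - S x) = -((P x - p') + p' * (1 - S x)) := by ring
      rw [h3, abs_neg]
      refine (abs_add_le _ _).trans ?_
      linarith) hElim
  have hTV := D.tendsto_T_div_V_atTop one_ne_zero hS
  rw [inv_one] at hTV
  have hlog : Tendsto (fun x => Real.log (T x / V x)) atTop (𝓝 0) := by
    simpa using hTV.log one_ne_zero
  have hfin : Tendsto (fun x => (1 - p') * Real.log (V x) - Real.log (A x)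
      - p' * Real.log (T x / V x)) atTop (𝓝 l) := by simpa using hl.sub (hlog.const_mul p')
  refine ⟨Real.exp l, Real.exp_pos l, ((Real.continuous_exp.tendsto l).comp hfin).congr fun x => ?_⟩
  have hV := D.V_pos x
  have hT := D.T_pos x
  have hA := D.A_pos x
  rw [Function.comp_apply, ← Real.exp_log (show 0 < V x / A x / T x ^ p' by positivity),
    Real.log_div hT.ne' hV.ne', Real.log_div (div_pos hV hA).ne' (by positivity),
    Real.log_div hV.ne' hA.ne', Real.log_rpow hT]
  ring_nf

/-- The equation P' = (1 - S)P - (m+n-1)A² has a repelling linear part, so P → 0 forces P to be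
slaved to its source A². Then (log (V/A))' = -P is exponentially small. -/
theorem exists_tendsto_const (D : OrbitData m n A B P Q S V T) (hA : Tendsto A atTop (𝓝 0))
    (hP : Tendsto P atTop (𝓝 0)) (hS : Tendsto S atTop (𝓝 (1 / n))) :
    ∃ l > 0, Tendsto (fun x => V x / A x) atTop (𝓝 l) := by
  have hm := D.two_le_m
  have hn := D.two_le_n
  have hn0 : 0 < 1 / n := by positivity
  have hn1 : 1 / n < 3 / 4 := by rw [div_lt_iff₀ (by linarith)]; linarith
  obtain ⟨x₀, hx₀⟩ := eventually_atTop.1 <|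
    ((hP.sub hS).eventually (gt_mem_nhds (by linarith : 0 - 1 / n < -(1 / n / 2)))).and
      (hS.eventually (gt_mem_nhds hn1))
  set k := m + n - 1 with hk
  have hk0 : 0 ≤ k := by linarith
  -- An integrating factor for the growth rate 1 - S: e^(-x) contributes -1 and 1/V contributes +S.
  have dw : ∀ x, HasDerivAt (fun x => Real.exp (-x) / V x)
      (-((1 - S x) * (Real.exp (-x) / V x))) x := fun x => by
    have hV := (D.V_pos x).ne'
    convert! ((hasDerivAt_neg x).exp).div (D.dV x) hV using 1
    field_simp
    ring
  have hw0 : ∀ x, 0 < Real.exp (-x) / V x := fun x => div_pos (Real.exp_pos _) (D.V_pos x)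
  have hs : ∀ x, 0 ≤ 1 - S x := fun x => by linarith [D.S_le_one x]
  have hP0 := nonpos_of_tendsto_zero (G := fun x => -P x) (x₀ := x₀) (fun x => (D.dP x).neg) dw hw0 hs
    (fun x _ => by
      have : 0 ≤ k * A x ^ 2 := by positivity
      linarith) (by simpa using hP.neg)
  -- The constant 4 is 1/(1 - 3/4): since S < 3/4 eventually, 4(1 - S) ≥ 1 absorbs the source term,
  -- and S - P ≥ 0 handles the derivative of A².
  have hPA := nonpos_of_tendsto_zero (G := fun x => P x - 4 * k * A x ^ 2) (x₀ := x₀)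
    (fun x => (D.dP x).sub ((D.hasDerivAt_A_sq x).const_mul (4 * k))) dw hw0 hs
    (fun x hx => by
      obtain ⟨h1, h2⟩ := hx₀ x hx
      have h3 : 0 ≤ k * A x ^ 2 := by positivity
      nlinarith [mul_nonneg h3 (by linarith : 0 ≤ S x - P x),
        mul_nonneg h3 (by linarith : 0 ≤ 3 / 4 - S x)]) (by
      simpa using hP.sub ((hA.pow 2).const_mul (4 * k)))
  obtain ⟨l, hl, -⟩ := exists_tendsto_of_abs_deriv_le
    (f := fun x => Real.log (V x) - Real.log (A x)) (K := 4 * k) (c := 1 / n) (x₀ := x₀)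
    hn0 (by positivity) (fun x => (D.hasDerivAt_log_V x).sub (D.hasDerivAt_log_A x))
    D.hasDerivAt_A_sq (fun x => by positivity)
    (fun x hx => by nlinarith [(hx₀ x hx).1, sq_nonneg (A x)])
    (fun x hx => by
      have h1 := hP0 x hx
      have h2 := hPA x hx
      rw [abs_le]
      constructor <;> nlinarith [sq_nonneg (A x)])
    (by simpa using hA.pow 2)
  refine ⟨Real.exp l, Real.exp_pos l, ((Real.continuous_exp.tendsto l).comp hl).congr fun x => ?_⟩
  rw [Function.comp_apply, ← Real.log_div (D.V_pos x).ne' (D.A_pos x).ne',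
    Real.exp_log (div_pos (D.V_pos x) (D.A_pos x))]

end OrbitData

/-! ### Constructing V and T from an orbit -/

lemma hasDerivAt_components {X : ℝ → ℝ × ℝ × ℝ × ℝ} {v : ℝ × ℝ × ℝ × ℝ} {x : ℝ}
    (h : HasDerivAt X v x) :
    HasDerivAt (fun x => (X x).1) v.1 x ∧ HasDerivAt (fun x => (X x).2.1) v.2.1 x ∧
      HasDerivAt (fun x => (X x).2.2.1) v.2.2.1 x ∧ HasDerivAt (fun x => (X x).2.2.2) v.2.2.2 x :=
  ⟨h.fst, h.snd.fst, h.snd.snd.fst, h.snd.snd.snd⟩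

lemma tendsto_components {X : ℝ → ℝ × ℝ × ℝ × ℝ} {l : Filter ℝ} {α β p q : ℝ}
    (h : Tendsto X l (𝓝 (α, β, p, q))) :
    Tendsto (fun x => (X x).1) l (𝓝 α) ∧ Tendsto (fun x => (X x).2.1) l (𝓝 β) ∧
      Tendsto (fun x => (X x).2.2.1) l (𝓝 p) ∧ Tendsto (fun x => (X x).2.2.2) l (𝓝 q) :=
  ⟨h.fst_nhds, h.snd_nhds.fst_nhds, h.snd_nhds.snd_nhds.fst_nhds, h.snd_nhds.snd_nhds.snd_nhds⟩

lemma IsOrbit.orbitData {m n : ℕ} (hm : 1 < m) (hn : 1 < n) {X : ℝ → ℝ × ℝ × ℝ × ℝ}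
    (hX : IsOrbit m n X) {S V T : ℝ → ℝ}
    (hS : ∀ x, S x = m * (X x).2.2.1 ^ 2 + n * (X x).2.2.2 ^ 2)
    (hV : ∀ x, 0 < V x) (dV : ∀ x, HasDerivAt V (-(S x * V x)) x)
    (dT : ∀ x, HasDerivAt T (-V x) x) (hT : Tendsto T atTop (𝓝 0)) :
    OrbitData m n (fun x => (X x).1) (fun x => (X x).2.1) (fun x => (X x).2.2.1)
      (fun x => (X x).2.2.2) S V T where
  two_le_m := by exact_mod_cast hm
  two_le_n := by exact_mod_cast hn
  A_pos x := (hX.mem x).2.2.1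
  B_pos x := (hX.mem x).2.2.2
  V_pos := hV
  lin x := by linarith [(hX.mem x).1]
  S_eq := hS
  quad x := by rw [hS]; linarith [(hX.mem x).2.1]
  dA x := by rw [hS]; exact (hasDerivAt_components (hX.deriv_eq x)).1
  dB x := by rw [hS]; exact (hasDerivAt_components (hX.deriv_eq x)).2.1
  dP x := by
    rw [hS]
    convert! (hasDerivAt_components (hX.deriv_eq x)).2.2.1 using 1
    simp only [vectorField]
    ring
  dQ x := by
    rw [hS]
    convert! (hasDerivAt_components (hX.deriv_eq x)).2.2.2 using 1
    simp only [vectorField]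
    ring
  dV := dV
  dT := dT
  T_lim := hT

lemma IsOrbit.exists_orbitData {m n : ℕ} (hm : 1 < m) (hn : 1 < n) {X : ℝ → ℝ × ℝ × ℝ × ℝ}
    (hX : IsOrbit m n X) : ∃ S V T, OrbitData m n (fun x => (X x).1) (fun x => (X x).2.1)
      (fun x => (X x).2.2.1) (fun x => (X x).2.2.2) S V T := by
  set S : ℝ → ℝ := fun x => m * (X x).2.2.1 ^ 2 + n * (X x).2.2.2 ^ 2 with hS
  have hXc : Continuous X := continuous_iff_continuousAt.2 fun x => (hX.deriv_eq x).continuousAt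
  have hSc : Continuous S := by fun_prop
  set V : ℝ → ℝ := fun x => Real.exp (-∫ y in (0 : ℝ)..x, S y) with hV
  have dV : ∀ x, HasDerivAt V (-(S x * V x)) x := fun x => by
    convert! (hSc.integral_hasStrictDerivAt 0 x).hasDerivAt.fun_neg.exp using 1
    ring
  have hVpos : ∀ x, 0 < V x := fun x => Real.exp_pos _
  have hVc : Continuous V := continuous_iff_continuousAt.2 fun x => (dV x).continuousAt
  set W : ℝ → ℝ := fun x => -∫ y in (0 : ℝ)..x, V y with hW
  have dW : ∀ x, HasDerivAt W (-V x) x := fun x =>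
    (hVc.integral_hasStrictDerivAt 0 x).hasDerivAt.neg
  -- From (m+n)S ≥ 1, W - (m+n)V increases. This bounds W below, so subtracting its infimum places
  -- the time origin at τ = ∞.
  have hmono : Monotone fun x => W x - (m + n) * V x :=
    monotone_of_hasDerivAt_nonneg (fun x => (dW x).sub ((dV x).const_mul _)) fun x => by
      have h1 : (m * (X x).2.2.1 + n * (X x).2.2.2 : ℝ) = 1 := by linarith [(hX.mem x).1]
      have h2 : (m + n : ℝ) * S x = (m * (X x).2.2.1 + n * (X x).2.2.2) ^ 2
          + m * n * ((X x).2.2.1 - (X x).2.2.2) ^ 2 := by simp only [hS]; ring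
      have h3 : 1 ≤ (m + n : ℝ) * S x := by
        rw [h2, h1]
        have : 0 ≤ (m * n * ((X x).2.2.1 - (X x).2.2.2) ^ 2 : ℝ) := by positivity
        linarith
      have := mul_le_mul_of_nonneg_right h3 (hVpos x).le
      simp only [Pi.zero_apply]
      linarith
  have hanti : Antitone W := fun x y h => antitoneOn_of_hasDerivAt convex_univ
    (fun x _ => dW x) (fun x _ => by linarith [hVpos x]) (mem_univ x) (mem_univ y) h
  have hbdd : BddBelow (range W) := by
    refine ⟨W 0 - (m + n) * V 0, ?_⟩
    rintro _ ⟨x, rfl⟩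
    rcases le_total 0 x with h | h
    · have h1 := hmono h
      have : 0 ≤ (m + n : ℝ) * V x := mul_nonneg (by positivity) (hVpos x).le
      simp only at h1
      linarith
    · have h1 := hanti h
      have : 0 ≤ (m + n : ℝ) * V 0 := mul_nonneg (by positivity) (hVpos 0).le
      linarith
  refine ⟨S, V, fun x => W x - ⨅ i, W i, hX.orbitData hm hn (fun x => rfl) hVpos dV
    (fun x => (dW x).sub_const _) ?_⟩
  simpa using (tendsto_atTop_ciInf hanti hbdd).sub_const (⨅ i, W i)

/-! ### Scale factors as functions of proper time -/

variable {m n : ℕ} {X : ℝ → ℝ × ℝ × ℝ × ℝ} {A B P Q S V T a b : ℝ → ℝ}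

namespace OrbitData

lemma hasDerivAt_scale (D : OrbitData m n A B P Q S V T) (ha : ∀ x, a (T x) = V x / A x)
    (x : ℝ) : HasDerivAt a (P x / A x) (T x) := by
  have hA := (D.A_pos x).ne'
  have hV := (D.V_pos x).ne'
  convert! D.hasDerivAt_comp_T ha ((D.dV x).div (D.dA x) hA) using 1
  field_simp
  ring

lemma curv_eq (D : OrbitData m n A B P Q S V T) (ha : ∀ x, a (T x) = V x / A x)
    (x : ℝ) : curv a (T x) = -P x / V x := by
  have hA := (D.A_pos x).ne'
  have hV := (D.V_pos x).ne'
  rw [curv, (D.hasDerivAt_scale ha x).deriv, ha]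
  field_simp

lemma meanCurv_eq (D : OrbitData m n A B P Q S V T) (ha : ∀ x, a (T x) = V x / A x)
    (hb : ∀ x, b (T x) = V x / B x) (x : ℝ) : meanCurv m n a b (T x) = -1 / V x := by
  rw [meanCurv, D.curv_eq ha, D.symm.curv_eq hb, ← D.lin x]
  ring

lemma hasDerivAt_curv (D : OrbitData m n A B P Q S V T) (ha : ∀ x, a (T x) = V x / A x)
    (x : ℝ) : HasDerivAt (curv a)
      (curv a (T x) * (-1 / V x) + (-1) * ((m + n - 1) / a (T x) ^ 2)) (T x) := by
  have hA := (D.A_pos x).ne'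
  have hV := (D.V_pos x).ne'
  convert! D.hasDerivAt_comp_T (D.curv_eq ha) ((D.dP x).fun_neg.fun_div (D.dV x) hV) using 1
  rw [D.curv_eq ha, ha]
  field_simp
  ring

lemma isVacuumSolution (D : OrbitData m n A B P Q S V T) (ha : ∀ x, a (T x) = V x / A x)
    (hb : ∀ x, b (T x) = V x / B x) : IsVacuumSolution m n (-1) (-1) a b (Ioi 0) := by
  have h : ∀ p : ℝ → Prop, (∀ x, p (T x)) → ∀ t ∈ Ioi (0 : ℝ), p t := fun p hp t ht => by
    rw [← D.range_T] at ht
    obtain ⟨x, rfl⟩ := ht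
    exact hp x
  constructor <;> refine h _ fun x => ?_
  · rw [ha]; exact div_pos (D.V_pos x) (D.A_pos x)
  · rw [hb]; exact div_pos (D.V_pos x) (D.B_pos x)
  · exact (D.hasDerivAt_scale ha x).differentiableAt
  · exact (D.symm.hasDerivAt_scale hb x).differentiableAt
  · rw [D.meanCurv_eq ha hb]; exact D.hasDerivAt_curv ha x
  · rw [D.meanCurv_eq ha hb, add_comm (m : ℝ)]; exact D.symm.hasDerivAt_curv hb x
  · have hA := (D.A_pos x).ne'
    have hB := (D.B_pos x).ne'
    have hV := (D.V_pos x).ne'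
    have hq := D.quad x
    rw [D.S_eq] at hq
    rw [D.meanCurv_eq ha hb, D.curv_eq ha, D.symm.curv_eq hb, ha, hb]
    field_simp
    linarith

lemma exists_generates (D : OrbitData m n A B P Q S V T) :
    ∃ a b, Generates m n (fun x => (A x, B x, P x, Q x)) T a b := by
  have hinv : ∀ x, Function.invFun T (T x) = x :=
    Function.leftInverse_invFun D.T_strictAnti.injective
  set a : ℝ → ℝ := fun t => V (Function.invFun T t) / A (Function.invFun T t)
  set b : ℝ → ℝ := fun t => V (Function.invFun T t) / B (Function.invFun T t)
  have ha : ∀ x, a (T x) = V x / A x := fun x => by simp only [a, hinv]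
  have hb : ∀ x, b (T x) = V x / B x := fun x => by simp only [b, hinv]
  refine ⟨a, b, fun x => ?_, D.T_lim, fun x => ?_, fun x => ?_,
    fun x => (D.hasDerivAt_scale ha x).differentiableAt,
    fun x => (D.symm.hasDerivAt_scale hb x).differentiableAt, fun x => ?_⟩
  · rw [D.meanCurv_eq ha hb]
    convert! D.dT x using 1
    have hV := (D.V_pos x).ne'
    field_simp
  · rw [ha]; exact div_pos (D.V_pos x) (D.A_pos x)
  · rw [hb]; exact div_pos (D.V_pos x) (D.B_pos x)
  · have hA := (D.A_pos x).ne'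
    have hB := (D.B_pos x).ne'
    have hV := (D.V_pos x).ne'
    simp only [scaleInvariant, Prod.mk.injEq]
    rw [D.meanCurv_eq ha hb, D.curv_eq ha, D.symm.curv_eq hb, ha, hb]
    refine ⟨?_, ?_, ?_, ?_⟩ <;> field_simp

end OrbitData

/-- Differentiability of H is not assumed. It comes from V = A · (a ∘ T), whose product rule, with
ȧ/H = -P a, yields V' = -S V. -/
lemma Generates.exists_orbitData (hm : 1 < m) (hn : 1 < n) (hX : IsOrbit m n X)
    (G : Generates m n X T a b) : ∃ S V, OrbitData m n (fun x => (X x).1) (fun x => (X x).2.1)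
      (fun x => (X x).2.2.1) (fun x => (X x).2.2.2) S V T ∧
      (∀ x, a (T x) = V x / (X x).1) ∧ ∀ x, b (T x) = V x / (X x).2.1 := by
  set V : ℝ → ℝ := fun x => -1 / meanCurv m n a b (T x) with hV
  have hA : ∀ x, (X x).1 = V x / a (T x) := fun x => by
    rw [← G.variables_eq x, hV, scaleInvariant, div_div, mul_comm]
  have hB : ∀ x, (X x).2.1 = V x / b (T x) := fun x => by
    rw [← G.variables_eq x, hV, scaleInvariant, div_div, mul_comm (meanCurv m n a b (T x))]
  have hP : ∀ x, (X x).2.2.1 = curv a (T x) / meanCurv m n a b (T x) := fun x => by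
    rw [← G.variables_eq x, scaleInvariant]
  have hVA : ∀ x, V x = (X x).1 * a (T x) := fun x => by
    rw [hA, div_mul_cancel₀ _ (G.a_pos x).ne']
  have hVpos : ∀ x, 0 < V x := fun x => by
    rw [hVA]; exact mul_pos (hX.mem x).2.2.1 (G.a_pos x)
  refine ⟨fun x => m * (X x).2.2.1 ^ 2 + n * (X x).2.2.2 ^ 2, V,
    hX.orbitData hm hn (fun _ => rfl) hVpos (fun x => ?_) (fun x => ?_) G.time_origin,
    fun x => ?_, fun x => ?_⟩
  · have h0 : meanCurv m n a b (T x) ≠ 0 := fun h => by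
      have := hVpos x
      simp [hV, h] at this
    have ha0 := (G.a_pos x).ne'
    have h1 : HasDerivAt (fun x => (X x).1 * a (T x)) _ x :=
      (hasDerivAt_components (hX.deriv_eq x)).1.mul ((G.a_diff x).hasDerivAt.comp x (G.time_deriv x))
    rw [← funext hVA] at h1
    convert! h1 using 1
    have h2 : deriv a (T x) * (1 / meanCurv m n a b (T x)) = -(X x).2.2.1 * a (T x) := by
      rw [hP, curv]
      field_simp
    rw [h2, hVA]
    simp only [vectorField]
    ring
  · convert! G.time_deriv x using 1
    simp only [hV]
    ring
  · have := (hVpos x).ne'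
    have := (G.a_pos x).ne'
    rw [hA]; field_simp
  · have := (hVpos x).ne'
    have := (G.b_pos x).ne'
    rw [hB]; field_simp

/-! ### Asymptotics in proper time at the equilibrium points -/

namespace OrbitData

lemma tendsto_S (D : OrbitData m n A B P Q S V T) {l : Filter ℝ} {p q : ℝ}
    (hP : Tendsto P l (𝓝 p)) (hQ : Tendsto Q l (𝓝 q)) :
    Tendsto S l (𝓝 (m * p ^ 2 + n * q ^ 2)) :=
  (((hP.pow 2).const_mul _).add ((hQ.pow 2).const_mul _)).congr fun x => (D.S_eq x).symm

lemma kasner_asymptotics (D : OrbitData m n A B P Q S V T) (ha : ∀ x, a (T x) = V x / A x)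
    {p q : ℝ} (hpq : m * p ^ 2 + n * q ^ 2 = 1) (hA : Tendsto A atTop (𝓝 0))
    (hB : Tendsto B atTop (𝓝 0)) (hP : Tendsto P atTop (𝓝 p)) (hQ : Tendsto Q atTop (𝓝 q)) :
    ∃ a₀ > 0, Tendsto (fun t : ℝ => a t / t ^ p) (𝓝[>] 0) (𝓝 a₀) := by
  obtain ⟨l, hl0, hl⟩ := D.exists_tendsto_kasner hpq hA hB hP hQ
  exact ⟨l, hl0, D.tendsto_nhdsGT_zero (fun x => by rw [ha]) hl⟩

lemma friedmann_asymptotics (D : OrbitData m n A B P Q S V T) (ha : ∀ x, a (T x) = V x / A x)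
    (hA : Tendsto A atBot (𝓝 (1 / (m + n)))) (hP : Tendsto P atBot (𝓝 (1 / (m + n))))
    (hQ : Tendsto Q atBot (𝓝 (1 / (m + n)))) :
    Tendsto (fun t : ℝ => a t / t) atTop (𝓝 1) := by
  have hm := D.two_le_m
  have hn := D.two_le_n
  have hmn : (m + n : ℝ) ≠ 0 := by positivity
  have hS : Tendsto S atBot (𝓝 (1 / (m + n))) := by
    convert! D.tendsto_S hP hQ using 2
    field_simp
  have h0 : (1 / (m + n) : ℝ) ≠ 0 := one_div_ne_zero hmn
  -- At F_* the limits of S and A coincide, so their quotient is 1.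
  have := tendsto_div_of_tendsto (D.tendsto_T_div_V_atBot h0 hS) h0 hA h0
  rw [div_self h0] at this
  exact D.tendsto_atTop (fun x => by rw [ha]) this

/-- Asymptotics of both scale factors at the equilibrium point `F_A`. -/
lemma pointA_asymptotics (D : OrbitData m n A B P Q S V T) (ha : ∀ x, a (T x) = V x / A x)
    (hb : ∀ x, b (T x) = V x / B x) (hA : Tendsto A atTop (𝓝 0))
    (hB : Tendsto B atTop (𝓝 (√((n - 1) / n ^ 2 * (1 / (m + n - 1))))))
    (hP : Tendsto P atTop (𝓝 0)) (hQ : Tendsto Q atTop (𝓝 (1 / n))) :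
    (∃ a₀ > 0, Tendsto a (𝓝[>] 0) (𝓝 a₀)) ∧
      Tendsto (fun t : ℝ => b t / t) (𝓝[>] 0) (𝓝 (√(m + n - 1) / √(n - 1))) := by
  have hm := D.two_le_m
  have hn := D.two_le_n
  have hn0 : (0 : ℝ) < n := by linarith
  have hn1 : (0 : ℝ) < n - 1 := by linarith
  have hk : (0 : ℝ) < m + n - 1 := by linarith
  have hS : Tendsto S atTop (𝓝 (1 / n)) := by
    convert! D.tendsto_S hP hQ using 2
    field_simp
    ring
  have h0 : (1 / n : ℝ) ≠ 0 := one_div_ne_zero hn0.ne'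
  obtain ⟨l, hl0, hl⟩ := D.exists_tendsto_const hA hP hS
  refine ⟨⟨l, hl0, D.tendsto_nhdsGT_zero ha hl⟩,
    D.tendsto_nhdsGT_zero (fun x => by rw [hb]) ?_⟩
  have hB0 : √((n - 1) / n ^ 2 * (1 / (m + n - 1)) : ℝ) ≠ 0 :=
    (Real.sqrt_pos.2 (by positivity)).ne'
  convert! tendsto_div_of_tendsto (D.tendsto_T_div_V_atTop h0 hS) h0 hB hB0 using 2
  rw [mul_one_div, Real.sqrt_div (by positivity), Real.sqrt_div hn1.le, Real.sqrt_sq hn0.le]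
  have := (Real.sqrt_pos.2 hn1).ne'
  have := (Real.sqrt_pos.2 hk).ne'
  field_simp

end OrbitData

end DoublyWarped

theorem mainTheorem3 (m n : ℕ) (hm : 1 < m) (hn : 1 < n) (X : ℝ → ℝ × ℝ × ℝ × ℝ)
    (hX : DoublyWarped.IsOrbit m n X) :
    (∃ T a b : ℝ → ℝ, DoublyWarped.Generates m n X T a b) ∧
    ∀ T a b : ℝ → ℝ, DoublyWarped.Generates m n X T a b →
      (StrictAnti T ∧ range T = Ioi 0 ∧
        DoublyWarped.IsVacuumSolution m n (-1) (-1) a b (Ioi 0)) ∧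
      (∀ p q : ℝ, DoublyWarped.IsKasner m n p q →
        Tendsto X atTop (𝓝 (DoublyWarped.kasnerPoint p q)) →
        (∃ a₀ > 0, Tendsto (fun t : ℝ => a t / t ^ p) (𝓝[>] 0) (𝓝 a₀)) ∧
        (∃ b₀ > 0, Tendsto (fun t : ℝ => b t / t ^ q) (𝓝[>] 0) (𝓝 b₀))) ∧
      (Tendsto X atBot (𝓝 (DoublyWarped.pointStar m n)) →
        Tendsto (fun t : ℝ => a t / t) atTop (𝓝 1) ∧
        Tendsto (fun t : ℝ => b t / t) atTop (𝓝 1)) ∧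
      (Tendsto X atTop (𝓝 (DoublyWarped.pointA m n)) →
        (∃ a₀ > 0, Tendsto a (𝓝[>] 0) (𝓝 a₀)) ∧
        Tendsto (fun t : ℝ => b t / t) (𝓝[>] 0) (𝓝 (√(m + n - 1) / √(n - 1)))) ∧
      (Tendsto X atTop (𝓝 (DoublyWarped.pointB m n)) →
        Tendsto (fun t : ℝ => a t / t) (𝓝[>] 0) (𝓝 (√(m + n - 1) / √(m - 1))) ∧
        (∃ b₀ > 0, Tendsto b (𝓝[>] 0) (𝓝 b₀))) := by
  refine ⟨?_, fun T a b G => ?_⟩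
  · obtain ⟨S, V, T, D⟩ := hX.exists_orbitData hm hn
    exact ⟨T, D.exists_generates⟩
  obtain ⟨S, V, D, ha, hb⟩ := G.exists_orbitData hm hn hX
  refine ⟨⟨D.T_strictAnti, D.range_T, D.isVacuumSolution ha hb⟩, fun p q hpq h => ?_,
    fun h => ?_, fun h => ?_, fun h => ?_⟩
  · obtain ⟨hA, hB, hP, hQ⟩ := DoublyWarped.tendsto_components h
    exact ⟨D.kasner_asymptotics ha hpq.2 hA hB hP hQ,
      D.symm.kasner_asymptotics hb (by rw [add_comm]; exact hpq.2) hB hA hQ hP⟩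
  · obtain ⟨hA, hB, hP, hQ⟩ := DoublyWarped.tendsto_components h
    refine ⟨D.friedmann_asymptotics ha hA hP hQ, ?_⟩
    rw [add_comm (m : ℝ)] at hB hP hQ
    exact D.symm.friedmann_asymptotics hb hB hQ hP
  · obtain ⟨hA, hB, hP, hQ⟩ := DoublyWarped.tendsto_components h
    exact D.pointA_asymptotics ha hb hA hB hP hQ
  · obtain ⟨hA, hB, hP, hQ⟩ := DoublyWarped.tendsto_components h
    rw [add_comm (m : ℝ)] at hA ⊢
    exact (D.symm.pointA_asymptotics hb ha hB hA hQ hP).symm
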